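/- Let $(R,\mathfrak m)$ be a (Noetherian) Cohen–Macaulay local ring of dimension one with infinite residue field. Write $\ell_R$ for length, let $S$ be the set of nonzerodivisors of $R$, and let $\overline R$ be the integral closure of $R$ in its total ring of fractions $S^{-1}R$. For an $\mathfrak m$-primary ideal $I$ and a finitely generated $R$-module $M$ of dimension one, let $e_1(I,M)$ be the integer such that $\ell_R(M/I^nM)=e_0(I,M)\,n-e_1(I,M)$ for all large $n$; for $\mathfrak m$-primary ideals $K$ and $I$, let $g_1^K(I)$ be the integer such that $\ell_R(R/KI^n)=g_0^K(I)\,n-g_1^K(I)$ for all large $n$. Put $$\Delta_R(M)=\{e_1(I,M): I\ \text{an } \mathfrak m\text{-primary ideal of } R\},\qquad \Delta^K(R)=\{g_1^K(I): I\ \text{an } \mathfrak m\text{-primary ideal of } R\}.$$ (1) Let $M$ be a maximal Cohen–Macaulay $R$-module (a nonzero finitely generated module with $\operatorname{depth} M=\dim M=\dim R$). Then $M\to S^{-1}M$ is injective, the integers $e_0(I,M)$ and $e_1(I,M)$ exist for every $\mathfrak m$-primary ideal $I$, and $$\Delta_R(M)\subseteq\{\ell_R(N/M): M\subseteq N\subseteq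 S^{-1}M,\ N \text{ a finitely generated } R\text{-submodule}\}.$$ (2) Let $K$ be an $\mathfrak m$-primary ideal of $R$. Then the integers $g_0^K(I)$ and $g_1^K(I)$ exist for every $\mathfrak m$-primary ideal $I$, and $$\Delta^K(R)=\{\ell_R(KB/K)-\ell_R(R/K): R\subseteq B\subseteq\overline R,\ B \text{ a subring that is finitely generated as an } R\text{-module}\};$$ in particular these lengths are finite. Further, in the extended real numbers, $$\sup\Delta^K(R)=\ell_R(K\overline R/K)-\ell_R(R/K),$$ where both sides may be $+\infty$. -/

import Mathlib

open Filter IsLocalRing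
open scoped ENNReal nonZeroDivisors

universe u v

namespace HilbertCoeff

section CohenMacaulay

variable (R : Type u) [CommRing R] [IsLocalRing R]
variable (M : Type v) [AddCommGroup M] [Module R M]

/-- The depth of a module `M` over a local ring: the supremum of the lengths of the `M`-regular
sequences of elements of the maximal ideal. -/
noncomputable def depth : ℕ∞ :=
  ⨆ (rs : List R) (_ : (∀ x ∈ rs, x ∈ maximalIdeal R) ∧ RingTheory.Sequence.IsRegular M rs),
    (rs.length : ℕ∞)

/-- A Cohen–Macaulay local ring: a Noetherian local ring whose depth is its Krull dimension. -/
def IsCohenMacaulayRing : Prop :=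
  IsNoetherianRing R ∧ ((depth R R : ℕ∞) : WithBot ℕ∞) = ringKrullDim R

/-- A maximal Cohen–Macaulay module: a nonzero finitely generated module with
`depth M = dim M = dim R`. -/
def IsMaximalCohenMacaulay : Prop :=
  Nontrivial M ∧ Module.Finite R M ∧
    ((depth R M : ℕ∞) : WithBot ℕ∞) = Module.supportDim R M ∧
    Module.supportDim R M = ringKrullDim R

end CohenMacaulay

section HilbertPolynomial

/-- The value at `n ≥ 1` of the polynomial `∑_{i=0}^r (-1)^i e_i binom(n+r-i-1, r-i)`. -/
def hilbertSum (r : ℕ) (e : ℕ → ℤ) (n : ℕ) : ℤ :=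
  ∑ i ∈ Finset.range (r + 1), (-1) ^ i * e i * ((n + r - i - 1).choose (r - i) : ℤ)

/-- `e_0, …, e_r` are the coefficients of a polynomial
`∑_{i=0}^r (-1)^i e_i binom(n+r-i-1, r-i)` that agrees with `f n` for all large `n`
(in particular `f n` is then finite for all large `n`). -/
def IsHilbertCoeffs (f : ℕ → ℕ∞) (r : ℕ) (e : ℕ → ℤ) : Prop :=
  ∀ᶠ n : ℕ in atTop, ∃ l : ℕ, f n = (l : ℕ∞) ∧ (l : ℤ) = hilbertSum r e n

/-- `f n` agrees for large `n` with a polynomial of the above form. -/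
def HasHilbertPolynomial (f : ℕ → ℕ∞) (r : ℕ) : Prop :=
  ∃ e : ℕ → ℤ, IsHilbertCoeffs f r e

open Classical in
/-- The `i`-th Hilbert coefficient of `f` with respect to `r` (for `i ≤ r`); it is `0` if there is
no Hilbert polynomial. -/
noncomputable def coeff (f : ℕ → ℕ∞) (r i : ℕ) : ℤ :=
  if h : HasHilbertPolynomial f r then h.choose i else 0

theorem hilbertSum_succ_sub (r : ℕ) (e : ℕ → ℤ) (n : ℕ) (hn : 1 ≤ n) :
    hilbertSum (r + 1) e (n + 1) - hilbertSum (r + 1) e n = hilbertSum r e (n + 1) := by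
  unfold hilbertSum
  rw [Finset.sum_range_succ, Finset.sum_range_succ (n := r + 1)]
  simp only [Nat.sub_self, Nat.choose_zero_right, add_sub_add_right_eq_sub]
  rw [← Finset.sum_sub_distrib]
  refine Finset.sum_congr rfl fun i hi => ?_
  have hi' : i ≤ r := by simpa [Nat.lt_succ_iff] using hi
  obtain ⟨k, rfl⟩ := Nat.exists_eq_add_of_le hi'
  obtain ⟨m, rfl⟩ := Nat.exists_eq_add_of_le' hn
  have h1 : m + 1 + 1 + (i + k + 1) - i - 1 = (m + k + 1) + 1 := by omega
  have h2 : m + 1 + (i + k + 1) - i - 1 = m + k + 1 := by omega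
  have h3 : m + 1 + 1 + (i + k) - i - 1 = m + k + 1 := by omega
  have h4 : i + k + 1 - i = k + 1 := by omega
  have h5 : i + k - i = k := by omega
  rw [h1, h2, h3, h4, h5, Nat.choose_succ_succ]
  push_cast
  ring

/-- The coefficients are determined by the values for large `n`. -/
theorem hilbertSum_unique (r : ℕ) (e e' : ℕ → ℤ)
    (h : ∀ᶠ n : ℕ in atTop, hilbertSum r e n = hilbertSum r e' n) :
    ∀ i ≤ r, e i = e' i := by
  induction r with
  | zero =>
    intro i hi
    obtain ⟨n, hn⟩ := h.exists
    obtain rfl : i = 0 := by omega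
    simpa [hilbertSum] using hn
  | succ r ih =>
    have key : ∀ i ≤ r, e i = e' i := by
      apply ih
      obtain ⟨N, hN⟩ := eventually_atTop.1 h
      refine eventually_atTop.2 ⟨N + 2, fun n hn => ?_⟩
      obtain ⟨m, rfl⟩ := Nat.exists_eq_add_of_le' (show 1 ≤ n by omega)
      rw [← hilbertSum_succ_sub r e m (by omega), ← hilbertSum_succ_sub r e' m (by omega),
        hN m (by omega), hN (m + 1) (by omega)]
    intro i hi
    rcases Nat.lt_or_ge i (r + 1) with hlt | hge
    · exact key i (by omega)
    · obtain rfl : i = r + 1 := by omega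
      obtain ⟨n, hn⟩ := h.exists
      unfold hilbertSum at hn
      rw [Finset.sum_range_succ, Finset.sum_range_succ (n := r + 1)] at hn
      rw [Finset.sum_congr rfl (fun j hj => by
        rw [key j (by simpa [Nat.lt_succ_iff] using hj)])] at hn
      simpa using hn

theorem coeff_eq {f : ℕ → ℕ∞} {r : ℕ} {e : ℕ → ℤ} (h : IsHilbertCoeffs f r e) {i : ℕ}
    (hi : i ≤ r) : coeff f r i = e i := by
  have hex : HasHilbertPolynomial f r := ⟨e, h⟩
  rw [coeff, dif_pos hex]
  refine hilbertSum_unique r _ _ ?_ i hi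
  filter_upwards [hex.choose_spec, h] with n h1 h2
  obtain ⟨l, hl, h1⟩ := h1
  obtain ⟨l', hl', h2⟩ := h2
  obtain rfl : l = l' := by exact_mod_cast hl.symm.trans hl'
  exact h1.symm.trans h2

end HilbertPolynomial

section Coefficients

variable {R : Type u} [CommRing R]

/-- The Krull dimension of a nonzero module of finite dimension, as a natural number. -/
noncomputable def dimNat (R : Type u) [CommRing R] (M : Type v) [AddCommGroup M] [Module R M] :
    ℕ :=
  ((Module.supportDim R M).unbotD 0).toNat

/-- The Hilbert–Samuel function `n ↦ ℓ_R(M / QⁿM)`. -/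
noncomputable def hilbertSamuel (Q : Ideal R) (M : Type v) [AddCommGroup M] [Module R M] (n : ℕ) :
    ℕ∞ :=
  Module.length R (M ⧸ (Q ^ n • (⊤ : Submodule R M)))

/-- The Hilbert function `n ↦ ℓ_R(R / KQⁿ)` of `Q` with respect to `K`. -/
noncomputable def hilbertRel (K Q : Ideal R) (n : ℕ) : ℕ∞ :=
  Module.length R (R ⧸ (K * Q ^ n))

/-- The Hilbert coefficient `e_i(Q, M)`. -/
noncomputable def eCoeff (i : ℕ) (Q : Ideal R) (M : Type v) [AddCommGroup M] [Module R M] : ℤ :=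
  coeff (hilbertSamuel Q M) (dimNat R M) i

/-- The Hilbert coefficient `g_i^K(Q)` of `Q` with respect to `K`. -/
noncomputable def gCoeff (i : ℕ) (K Q : Ideal R) : ℤ :=
  coeff (hilbertRel K Q) (dimNat R R) i

/-- `I` is primary to the maximal ideal of the local ring `R`. -/
def IsMPrimary [IsLocalRing R] (I : Ideal R) : Prop :=
  I.IsPrimary ∧ I.radical = maximalIdeal R

/-- `Δ_R(M) = {e_1(I, M) : I is an 𝔪-primary ideal}`. -/
def deltaModule (R : Type u) [CommRing R] [IsLocalRing R]
    (M : Type v) [AddCommGroup M] [Module R M] : Set ℤ :=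
  {c | ∃ I : Ideal R, IsMPrimary I ∧ c = eCoeff 1 I M}

/-- `Δ^K(R) = {g_1^K(I) : I is an 𝔪-primary ideal}`. -/
def deltaRel [IsLocalRing R] (K : Ideal R) : Set ℤ :=
  {c | ∃ I : Ideal R, IsMPrimary I ∧ c = gCoeff 1 K I}

end Coefficients

section Lengths

variable (R : Type u) [CommRing R]

/-- The length of a module as an extended real number (`⊤` for infinite length). -/
noncomputable def lengthE (X : Type v) [AddCommGroup X] [Module R X] : EReal :=
  ((Module.length R X : ℝ≥0∞) : EReal)

/-- The canonical embedding of the integers into the extended reals. -/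
noncomputable def intE (c : ℤ) : EReal := ((c : ℝ) : EReal)

/-- For submodules `P ≤ N` of a module, the length of `N / P`. -/
noncomputable def relLength {X : Type v} [AddCommGroup X] [Module R X] (P N : Submodule R X) :
    EReal :=
  lengthE R (N ⧸ P.submoduleOf N)

/-- The image of `M` in `S⁻¹M`, where `S` is the set of nonzerodivisors of `R`. -/
noncomputable def imageInLocalization (M : Type v) [AddCommGroup M] [Module R M] :
    Submodule R (LocalizedModule R⁰ M) :=
  LinearMap.range (LocalizedModule.mkLinearMap R⁰ M)

variable {R}

/-- The ideal `K`, seen as an `R`-submodule of the total ring of fractions. -/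
noncomputable def idealImage (K : Ideal R) : Submodule R (FractionRing R) :=
  Submodule.map (Algebra.linearMap R (FractionRing R)) K

/-- The `R`-submodule `KB` of the total ring of fractions generated by the products of elements
of the ideal `K` and of the subring `B`. -/
noncomputable def extend (K : Ideal R) (B : Subalgebra R (FractionRing R)) :
    Submodule R (FractionRing R) :=
  K • Subalgebra.toSubmodule B

theorem idealImage_le_extend (K : Ideal R) (B : Subalgebra R (FractionRing R)) :
    idealImage K ≤ extend K B := by
  rintro _ ⟨a, ha, rfl⟩
  have h := Submodule.smul_mem_smul (N := Subalgebra.toSubmodule B) ha B.one_mem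
  rwa [Algebra.linearMap_apply, Algebra.algebraMap_eq_smul_one]

end Lengths

end HilbertCoeff

/-! Everything rests on principal reductions. Since the residue field is infinite and `𝔪` contains a
nonzerodivisor of finite colength, each `𝔪`-primary `I` contains some `a` with `I ^ (r + 1) = a I ^
r` (`exists_reduction`), and `a` is again a nonzerodivisor of finite colength.

Let `P` be a finitely generated submodule of a module on which `a` acts bijectively, and put `P' =
a⁻ʳ Iʳ P ⊇ P`. For `n ≥ r` one has `Iⁿ P = aⁿ P'`, so `aⁿ P ⊆ aⁿ P' ⊆ P`. Multiplication by `aⁿ`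
preserves lengths, hence `ℓ(P / Iⁿ P) = n ℓ(P / aP) - ℓ(P' / P)` (`quotLen_pow_smul_add`). With `P =
M` inside `S⁻¹M` this gives `e₁(I, M) = ℓ(P' / M)`, which is (1).

For (2), the blowup `B = a⁻ʳ Iʳ` of `R` is a finite subalgebra and the blowup of `K` is `KB`, so `g₁
= ℓ(KB / K) - ℓ(R / K)`. Conversely, a finite subalgebra `B` has a common denominator, so a suitable
`aB` is an ideal `I` of `R` with `I² = aI`, and its blowup is `B` (`exists_isMPrimary_blowup_eq`).
For the supremum: if the lengths `ℓ(KB / K)` are bounded, one is maximal, and adjoining any integral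
element to that `B` cannot enlarge `KB`; otherwise both sides are infinite. -/

namespace HilbertCoeff

/-! ### Lengths of subquotients of a fixed module. -/

section QuotLen

variable {R : Type*} [CommRing R] {X Y : Type*} [AddCommGroup X] [Module R X]
  [AddCommGroup Y] [Module R Y]

/-- The length of `N / (P ∩ N)` for submodules `P`, `N` of a module. -/
noncomputable def quotLen (P N : Submodule R X) : ℕ∞ := Module.length R (N ⧸ P.submoduleOf N)

theorem quotLen_le_of_map (f : X →ₗ[R] Y) {P N : Submodule R X} {P' N' : Submodule R Y}
    (hN : ∀ x ∈ N, f x ∈ N') (hP : ∀ x ∈ N, f x ∈ P' ↔ x ∈ P) :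
    quotLen P N ≤ quotLen P' N' := by
  let g : N →ₗ[R] N' := f.restrict hN
  have hg : P.submoduleOf N = (P'.submoduleOf N').comap g := by
    ext x
    exact (hP x x.2).symm
  refine Module.length_le_of_injective (Submodule.mapQ _ _ g hg.le) ?_
  rw [← LinearMap.ker_eq_bot, Submodule.mapQ, Submodule.ker_liftQ_eq_bot]
  rw [LinearMap.ker_comp, Submodule.ker_mkQ, hg]

theorem quotLen_ge_of_map (f : X →ₗ[R] Y) {P N : Submodule R X} {P' N' : Submodule R Y}
    (hN : ∀ x ∈ N, f x ∈ N') (hP : ∀ x ∈ N, x ∈ P → f x ∈ P') (hs : N' ≤ N.map f ⊔ P') :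
    quotLen P' N' ≤ quotLen P N := by
  let g : N →ₗ[R] N' := f.restrict hN
  have hg : P.submoduleOf N ≤ (P'.submoduleOf N').comap g := fun x hx => hP x x.2 hx
  refine Module.length_le_of_surjective (Submodule.mapQ _ _ g hg) ?_
  intro y
  obtain ⟨y, rfl⟩ := Submodule.Quotient.mk_surjective _ y
  obtain ⟨_, ⟨x, hx, rfl⟩, p, hp, h⟩ := Submodule.mem_sup.1 (hs y.2)
  refine ⟨Submodule.Quotient.mk ⟨x, hx⟩, ?_⟩
  rw [Submodule.mapQ_apply, Submodule.Quotient.eq]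
  change f x - (y : Y) ∈ P'
  rw [← h]
  simpa using hp

theorem quotLen_eq_of_map (f : X →ₗ[R] Y) {P N : Submodule R X} {P' N' : Submodule R Y}
    (hN : ∀ x ∈ N, f x ∈ N') (hP : ∀ x ∈ N, f x ∈ P' ↔ x ∈ P) (hs : N' ≤ N.map f ⊔ P') :
    quotLen P N = quotLen P' N' :=
  le_antisymm (quotLen_le_of_map f hN hP)
    (quotLen_ge_of_map f hN (fun x hx h => (hP x hx).2 h) hs)

theorem quotLen_map_map {f : X →ₗ[R] Y} (hf : Function.Injective f) (P N : Submodule R X) :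
    quotLen (P.map f) (N.map f) = quotLen P N :=
  (quotLen_eq_of_map f (fun _ hx => Submodule.mem_map_of_mem hx)
    (fun _ _ => hf.mem_set_image) le_sup_left).symm

theorem quotLen_add {P N T : Submodule R X} (h₁ : P ≤ N) (h₂ : N ≤ T) :
    quotLen P N + quotLen N T = quotLen P T := by
  symm
  have hle : P.submoduleOf T ≤ N.submoduleOf T := fun x hx => h₁ hx
  have hc : P.submoduleOf N = (P.submoduleOf T).comap (Submodule.inclusion h₂) := rfl
  refine Module.length_eq_add_of_exact
    (Submodule.mapQ (P.submoduleOf N) (P.submoduleOf T) (Submodule.inclusion h₂) hc.le)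
    (Submodule.factor hle) ?_ (Submodule.factor_surjective hle) ?_
  · rw [← LinearMap.ker_eq_bot, Submodule.mapQ, Submodule.ker_liftQ_eq_bot]
    rw [LinearMap.ker_comp, Submodule.ker_mkQ, hc]
  · intro x
    obtain ⟨x, rfl⟩ := Submodule.Quotient.mk_surjective _ x
    constructor
    · intro h
      have h' : (Submodule.Quotient.mk x : T ⧸ N.submoduleOf T) = 0 := h
      rw [Submodule.Quotient.mk_eq_zero] at h'
      exact ⟨Submodule.Quotient.mk ⟨x, h'⟩, rfl⟩
    · rintro ⟨y, hy⟩
      obtain ⟨y, rfl⟩ := Submodule.Quotient.mk_surjective _ y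
      rw [← hy]
      change (Submodule.Quotient.mk (Submodule.inclusion h₂ y) : T ⧸ N.submoduleOf T) = 0
      rw [Submodule.Quotient.mk_eq_zero]
      exact y.2

theorem quotLen_mono {P N N' : Submodule R X} (h : N ≤ N') : quotLen P N ≤ quotLen P N' :=
  quotLen_le_of_map LinearMap.id (fun _ hx => h hx) (fun _ _ => Iff.rfl)

theorem quotLen_anti {P P' N : Submodule R X} (h : P ≤ P') : quotLen P' N ≤ quotLen P N :=
  quotLen_ge_of_map LinearMap.id (fun _ hx => hx) (fun _ _ hx => h hx)
    (by simp)

theorem quotLen_eq_zero_iff {P N : Submodule R X} : quotLen P N = 0 ↔ N ≤ P := by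
  rw [quotLen, Module.length_eq_zero_iff, Submodule.Quotient.subsingleton_iff,
    Submodule.submoduleOf_eq_top]

theorem quotLen_top (P : Submodule R X) : quotLen P ⊤ = Module.length R (X ⧸ P) := by
  rw [quotLen]
  refine (Submodule.Quotient.equiv _ _ Submodule.topEquiv ?_).length_eq
  ext x
  simp [Submodule.submoduleOf]

/-- The only prime over the annihilator is the maximal ideal, so `X` is a finite module over the
Artinian ring `R ⧸ Ann X`. -/
theorem length_ne_top_of_pow_smul [IsLocalRing R] [IsNoetherianRing R] [Module.Finite R X] {k : ℕ}
    (h : ∀ r ∈ maximalIdeal R ^ k, ∀ x : X, r • x = 0) : Module.length R X ≠ ⊤ := by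
  rcases subsingleton_or_nontrivial X with hX | hX
  · simp
  let J := Module.annihilator R X
  have hJ : maximalIdeal R ^ k ≤ J := fun r hr => Module.mem_annihilator.2 (h r hr)
  have hJ' : J ≤ maximalIdeal R := by
    refine le_maximalIdeal fun hJ => ?_
    obtain ⟨x, hx⟩ := exists_ne (0 : X)
    have h1 : (1 : R) ∈ J := hJ ▸ Submodule.mem_top
    exact hx (by simpa using Module.mem_annihilator.1 h1 x)
  have hmin : maximalIdeal R ∈ J.minimalPrimes :=
    ⟨⟨inferInstance, hJ'⟩, fun q hq _ => hq.1.le_of_pow_le (hJ.trans hq.2)⟩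
  have := quotient_artinian_of_mem_minimalPrimes_of_isLocalRing J hmin
  let _ : Module (R ⧸ J) X := Module.quotientAnnihilator
  have : IsScalarTower R (R ⧸ J) X := (Module.isTorsionBySet_annihilator R X).isScalarTower
  have : Module.Finite (R ⧸ J) X := Module.Finite.of_restrictScalars_finite R _ _
  have : IsArtinian R X :=
    isArtinian_of_surjective_algebraMap (R := R ⧸ J) Ideal.Quotient.mk_surjective
  exact Module.length_ne_top

theorem quotLen_ne_top [IsLocalRing R] [IsNoetherianRing R] {P N : Submodule R X} (hN : N.FG)
    {k : ℕ} (h : maximalIdeal R ^ k • N ≤ P) : quotLen P N ≠ ⊤ := by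
  have : Module.Finite R N := Module.Finite.iff_fg.2 hN
  refine length_ne_top_of_pow_smul (k := k) fun r hr x => ?_
  obtain ⟨x, rfl⟩ := Submodule.Quotient.mk_surjective _ x
  rw [← Submodule.Quotient.mk_smul, Submodule.Quotient.mk_eq_zero]
  exact h (Submodule.smul_mem_smul hr x.2)

end QuotLen

/-! ### Superficial elements, from the Rees algebra and Artin–Rees. -/

section Superficial

open Polynomial

variable {R : Type u} [CommRing R]

/-- Over a local ring with infinite residue field, a generic element of the image of a linear map
`φ : V → A` lies in no associated prime of `A ⧸ J` except those containing all of `φ(V)`. -/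
theorem exists_forall_mem_associatedPrimes [IsLocalRing R] [Infinite (ResidueField R)]
    {A : Type*} [CommRing A] [IsNoetherianRing A] [Algebra R A] {V : Type*} [AddCommGroup V]
    [Module R V] (φ : V →ₗ[R] A) (J : Ideal A) :
    ∃ a : V, ∀ P ∈ associatedPrimes A (A ⧸ J), φ a ∈ P → ∀ v, φ v ∈ P := by
  let p : Ideal A → Submodule R V := fun P => (P.restrictScalars R).comap φ
  by_contra! hcon
  classical
  let s := (associatedPrimes.finite A (A ⧸ J)).toFinset.filter (fun P => ∃ v, φ v ∉ P)
  -- If no such `a` existed, `V` would be a finite union of the proper submodules `φ⁻¹(P)`, so one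
  -- of them would have finite index.
  obtain ⟨P, hP, hfi⟩ := Submodule.exists_finiteIndex_of_cover (p := p) (s := s) (by
    refine Set.eq_univ_of_forall fun c => ?_
    obtain ⟨P, hP, hc, hne⟩ := hcon c
    exact Set.mem_biUnion (x := P) (by simp [s, hP, hne]) hc)
  simp only [s, Finset.mem_filter, Set.Finite.mem_toFinset] at hP
  have : Finite (V ⧸ p P) := AddSubgroup.finite_quotient_of_finiteIndex
  obtain ⟨hPa, c, hc⟩ := hP
  refine not_finite_iff_infinite.2 ‹Infinite (ResidueField R)› ?_
  -- For `c` outside `p P`, no unit kills the class of `c`; thus distinct residue classes have lifts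
  -- with distinct images in the finite module `V ⧸ p P`.
  let g : R →ₗ[R] V ⧸ p P := LinearMap.toSpanSingleton R _ (Submodule.Quotient.mk c)
  have hg : ∀ r, g r = 0 → r ∈ maximalIdeal R := by
    intro r hr
    by_contra hu
    have hu : IsUnit r := by simpa using hu
    apply hc
    have : r • c ∈ p P := by
      rw [← Submodule.Quotient.mk_eq_zero]
      simpa [g] using hr
    exact (Submodule.smul_mem_iff_of_isUnit (p P) hu).1 this
  obtain ⟨σ, hσ⟩ : ∃ σ : ResidueField R → R, ∀ k, residue R (σ k) = k :=
    ⟨_, Function.surjInv_eq residue_surjective⟩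
  refine Finite.of_injective (fun k => g (σ k)) fun k l hkl => ?_
  have : σ k - σ l ∈ maximalIdeal R := hg _ (by rw [map_sub, sub_eq_zero]; exact hkl)
  rw [← residue_eq_zero_iff, map_sub, hσ, hσ, sub_eq_zero] at this
  exact this

/-- If `φ a` kills the class of `x` in `A ⧸ J`, then it lies in every minimal prime of the
annihilator of that class. These primes are associated to `A ⧸ J`, so by the choice of `a` they
contain all of `φ(V)`, and a power of the ideal it generates kills `x`. -/
theorem exists_forall_pow_mul_mem [IsLocalRing R] [Infinite (ResidueField R)]
    {A : Type*} [CommRing A] [IsNoetherianRing A] [Algebra R A] {V : Type*} [AddCommGroup V]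
    [Module R V] (φ : V →ₗ[R] A) (J : Ideal A) :
    ∃ a : V, ∀ x : A, φ a * x ∈ J →
      ∃ N, ∀ q ∈ Ideal.span (Set.range φ) ^ N, q * x ∈ J := by
  obtain ⟨a, ha⟩ := exists_forall_mem_associatedPrimes φ J
  refine ⟨a, fun x hx => ?_⟩
  let L : Submodule A (A ⧸ J) := Submodule.span A {(Ideal.Quotient.mk J x : A ⧸ J)}
  have hL : ∀ q : A, q ∈ Module.annihilator A L ↔ q * x ∈ J := by
    intro q
    rw [Submodule.mem_annihilator_span_singleton, ← Ideal.Quotient.eq_zero_iff_mem]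
    rfl
  have hD : Ideal.span (Set.range φ) ≤ (Module.annihilator A L).radical := by
    rw [← Ideal.sInf_minimalPrimes]
    refine le_sInf fun P hP => Ideal.span_le.2 ?_
    rintro _ ⟨v, rfl⟩
    have hP' := associatedPrimes.subset_of_injective L.injective_subtype
      (Module.associatedPrimes.minimalPrimes_annihilator_subset_associatedPrimes A L hP)
    exact ha P hP' (hP.1.2 ((hL _).2 hx)) v
  obtain ⟨N, hN⟩ := Ideal.exists_pow_le_of_le_radical_of_fg hD (IsNoetherian.noetherian _)
  exact ⟨N, fun q hq => (hL q).1 (hN hq)⟩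

/-- The ideal `⨁ 𝔪 Iⁿ` of the Rees algebra of `I`. -/
def reesCoeffIdeal (m I : Ideal R) : Ideal (reesAlgebra I) where
  carrier := {p | ∀ n, (p : R[X]).coeff n ∈ m * I ^ n}
  add_mem' hp hq n := by simpa using add_mem (hp n) (hq n)
  zero_mem' n := by simp
  smul_mem' q p hp n := by
    change ((q : R[X]) * p).coeff n ∈ _
    rw [coeff_mul]
    refine Ideal.sum_mem _ fun ij hij => ?_
    rw [← Finset.HasAntidiagonal.mem_antidiagonal.1 hij, pow_add, mul_left_comm]
    exact Ideal.mul_mem_mul (q.2 _) (hp _)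

theorem monomial_mem_reesCoeffIdeal {m I : Ideal R} {n : ℕ} {c : R} (hc : c ∈ m * I ^ n)
    {p : reesAlgebra I} (hp : (p : R[X]) = monomial n c) : p ∈ reesCoeffIdeal m I := by
  intro k
  rw [hp, coeff_monomial]
  split_ifs with h
  · exact h ▸ hc
  · exact zero_mem _

/-- The elements of degree one of the Rees algebra. -/
noncomputable def reesDegreeOne (I : Ideal R) : I →ₗ[R] reesAlgebra I where
  toFun c := ⟨monomial 1 (c : R), reesAlgebra.monomial_mem.2 (by simp)⟩
  map_add' c d := Subtype.ext (by simp)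
  map_smul' r c := Subtype.ext (by simp [smul_monomial])

/-- The Rees algebra is generated in degree one; this turns powers of the degree-one ideal into
powers of `I`. -/
theorem monomial_mem_span_pow {I : Ideal R} (N : ℕ) {y : R} (hy : y ∈ I ^ N) :
    (⟨monomial N y, reesAlgebra.monomial_mem.2 hy⟩ : reesAlgebra I) ∈
      Ideal.span (Set.range (reesDegreeOne I)) ^ N := by
  induction N generalizing y with
  | zero => simp
  | succ N ih =>
    suffices h : ∃ q ∈ Ideal.span (Set.range (reesDegreeOne I)) ^ (N + 1),
        (q : R[X]) = monomial (N + 1) y by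
      obtain ⟨q, hq, h⟩ := h
      convert hq
      exact h.symm
    rw [pow_succ] at hy
    refine Submodule.mul_induction_on hy (fun b hb c hc => ?_) ?_
    · have hm := Ideal.mul_mem_mul (ih hb)
        (Ideal.subset_span ⟨⟨c, hc⟩, rfl⟩ :
          reesDegreeOne I ⟨c, hc⟩ ∈ Ideal.span (Set.range (reesDegreeOne I)))
      rw [← pow_succ] at hm
      exact ⟨_, hm, monomial_mul_monomial N 1 b c⟩
    · rintro x y ⟨p, hp, hpx⟩ ⟨q, hq, hqy⟩
      exact ⟨p + q, add_mem hp hq, by simp [hpx, hqy]⟩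

/-- An element of `I` that lies in no associated prime of `⨁ Iⁿ / 𝔪 Iⁿ` except those containing
all of degree one. -/
theorem exists_mem_forall_pow_mul_mem [IsLocalRing R] [IsNoetherianRing R]
    [Infinite (ResidueField R)] (I : Ideal R) :
    ∃ a ∈ I, ∀ n, ∀ z ∈ I ^ n, a * z ∈ maximalIdeal R * I ^ (n + 1) →
      ∃ N, ∀ y ∈ I ^ N, y * z ∈ maximalIdeal R * I ^ (N + n) := by
  obtain ⟨a, ha⟩ := exists_forall_pow_mul_mem (reesDegreeOne I)
    (reesCoeffIdeal (maximalIdeal R) I)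
  refine ⟨a, a.2, fun n z hz haz => ?_⟩
  obtain ⟨N, hN⟩ := ha ⟨monomial n z, reesAlgebra.monomial_mem.2 hz⟩
    (monomial_mem_reesCoeffIdeal haz (by
      change monomial 1 (a : R) * monomial n z = _
      rw [monomial_mul_monomial, add_comm]))
  refine ⟨N, fun y hy => ?_⟩
  have h := hN _ (monomial_mem_span_pow N hy) (N + n)
  change (monomial N y * monomial n z : R[X]).coeff (N + n) ∈ _ at h
  rwa [monomial_mul_monomial, coeff_monomial_same] at h

/-- The elements of `Iⁿ` whose product with `a` lies in `𝔪 Iⁿ⁺¹`, as a filtration. -/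
def smulMemFiltration (m I : Ideal R) (a : R) : I.Filtration R where
  N n := I ^ n ⊓ Submodule.comap (LinearMap.mulLeft R a) (m * I ^ (n + 1))
  mono n := inf_le_inf (Ideal.pow_le_pow_right n.le_succ)
    (Submodule.comap_mono (Ideal.mul_mono_right (Ideal.pow_le_pow_right (n + 1).le_succ)))
  smul_le n := by
    rw [Submodule.smul_le]
    rintro r hr z ⟨hz, hz'⟩
    refine ⟨?_, ?_⟩
    · rw [pow_succ']
      exact Ideal.mul_mem_mul hr hz
    · change a * (r * z) ∈ m * I ^ (n + 1 + 1)
      have haz : a * z ∈ m * I ^ (n + 1) := hz'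
      have := Ideal.mul_mem_mul hr haz
      convert this using 1
      · ring
      · ring

theorem mem_smulMemFiltration {m I : Ideal R} {a : R} {n : ℕ} {z : R} :
    z ∈ (smulMemFiltration m I a).N n ↔ z ∈ I ^ n ∧ a * z ∈ m * I ^ (n + 1) := Iff.rfl

/-- The elements to be controlled form a filtration `F` inside the `I`-adic one, stable by
Artin–Rees, so `F (n₀ + k) = Iᵏ F n₀`. As `F n₀` is finitely generated, a single exponent pushes all
of it into `𝔪 Iⁿ`. -/
theorem exists_mem_eventually_mul_mem [IsLocalRing R] [IsNoetherianRing R]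
    [Infinite (ResidueField R)] (I : Ideal R) :
    ∃ a ∈ I, ∃ n₀, ∀ n ≥ n₀, ∀ z ∈ I ^ n, a * z ∈ maximalIdeal R * I ^ (n + 1) →
      z ∈ maximalIdeal R * I ^ n := by
  obtain ⟨a, ha, h⟩ := exists_mem_forall_pow_mul_mem I
  refine ⟨a, ha, ?_⟩
  let F := smulMemFiltration (maximalIdeal R) I a
  have hF : F.Stable := (I.stableFiltration_stable ⊤).of_le fun n z hz => by
    simpa using (mem_smulMemFiltration.1 hz).1
  obtain ⟨n₀, hn₀⟩ := hF.exists_pow_smul_eq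
  have key : ∀ z ∈ F.N n₀, ∃ N, ∀ k ≥ N, ∀ y ∈ I ^ k, y * z ∈ maximalIdeal R * I ^ (k + n₀) := by
    intro z hz
    obtain ⟨N, hN⟩ := h n₀ z (mem_smulMemFiltration.1 hz).1 (mem_smulMemFiltration.1 hz).2
    refine ⟨N, fun k hk y hy => ?_⟩
    obtain ⟨j, rfl⟩ := Nat.exists_eq_add_of_le hk
    have hle : I ^ (N + j) ≤ Submodule.comap (LinearMap.mulRight R z)
        (maximalIdeal R * I ^ (N + j + n₀)) := by
      rw [pow_add]
      refine Ideal.mul_le.2 fun b hb c hc => ?_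
      change b * c * z ∈ maximalIdeal R * I ^ (N + j + n₀)
      have := Ideal.mul_mem_mul (hN b hb) hc
      convert this using 1
      · ring
      · ring
    exact hle hy
  obtain ⟨K, hK⟩ : ∃ N, ∀ z ∈ F.N n₀, ∀ k ≥ N, ∀ y ∈ I ^ k,
      y * z ∈ maximalIdeal R * I ^ (k + n₀) := by
    obtain ⟨s, hs⟩ := IsNoetherian.noetherian (F.N n₀)
    choose! N hN using key
    refine ⟨s.sup N, fun z hz k hk y hy => ?_⟩
    rw [← hs] at hz
    induction hz using Submodule.span_induction with
    | mem x hx =>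
      exact hN x (hs ▸ Submodule.subset_span hx) k ((Finset.le_sup hx).trans hk) y hy
    | zero => simp
    | add u v _ _ hu hv => rw [mul_add]; exact add_mem hu hv
    | smul r u _ hu =>
      rw [smul_eq_mul, mul_left_comm]
      exact Ideal.mul_mem_left _ _ hu
  refine ⟨n₀ + K, fun n hn z hz haz => ?_⟩
  obtain ⟨k, rfl⟩ := Nat.exists_eq_add_of_le ((Nat.le_add_right _ _).trans hn)
  have hz' : z ∈ F.N (n₀ + k) := mem_smulMemFiltration.2 ⟨hz, haz⟩
  rw [hn₀ k] at hz'
  have : I ^ k • F.N n₀ ≤ maximalIdeal R * I ^ (n₀ + k) := by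
    rw [Submodule.smul_le]
    intro y hy w hw
    rw [add_comm n₀]
    exact hK w hw k (by omega) y hy
  exact this hz'

end Superficial

/-! ### Existence of principal reductions. -/

section Reduction

variable {R : Type u} [CommRing R]

/-- As `xJ ⊆ 𝔪J`, it suffices that `ℓ(J / xJ) = ℓ(R / xR)`. Compute `ℓ(R / xJ)` through `J` and
through `xR`, use `xR / xJ ≅ R / J`, and cancel the finite length `ℓ(R / J)`. The bound does not
depend on `J`. -/
theorem quotLen_mul_le [IsLocalRing R] [IsNoetherianRing R] {x : R} (hx : x ∈ maximalIdeal R)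
    (hreg : x ∈ R⁰) {J : Ideal R} {j : ℕ} (hJ : maximalIdeal R ^ j ≤ J) :
    quotLen (maximalIdeal R * J) J ≤ quotLen (Ideal.span {x}) (⊤ : Ideal R) := by
  let f : R →ₗ[R] R := LinearMap.mulLeft R x
  have hf : Function.Injective f := fun y z h =>
    (mul_cancel_left_mem_nonZeroDivisors hreg).1 h
  have hmap : Submodule.map f ⊤ = Ideal.span {x} := by
    ext y
    simp [f, Ideal.mem_span_singleton', mul_comm]
  have hle : Submodule.map f J ≤ maximalIdeal R * J := by
    rintro _ ⟨y, hy, rfl⟩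
    exact Ideal.mul_mem_mul hx hy
  have hfin : quotLen J (⊤ : Ideal R) ≠ ⊤ :=
    quotLen_ne_top (IsNoetherian.noetherian _) (k := j) (by simpa using hJ)
  refine (quotLen_anti hle).trans ?_
  have h₁ := quotLen_add (hle.trans Ideal.mul_le_right) (le_top : J ≤ ⊤)
  have h₂ := quotLen_add (Submodule.map_mono (f := f) (le_top : J ≤ ⊤)) le_top
  rw [quotLen_map_map hf, hmap, ← h₁, add_comm] at h₂
  exact ((ENat.add_left_injective_of_ne_top hfin).eq_iff.1 h₂).ge

theorem exists_eq_succ_of_bounded {d : ℕ → ℕ∞} {b : ℕ∞} (hb : b ≠ ⊤) (hd : ∀ n, d n ≤ b)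
    {n₀ : ℕ} (hmono : ∀ n ≥ n₀, d n ≤ d (n + 1)) : ∃ n ≥ n₀, d (n + 1) = d n := by
  by_contra! hne
  have key : ∀ i : ℕ, (i : ℕ∞) ≤ d (n₀ + i) := by
    intro i
    induction i with
    | zero => simp
    | succ i ih =>
      have hlt : d (n₀ + i) < d (n₀ + i + 1) :=
        lt_of_le_of_ne (hmono _ (by omega)) (hne _ (by omega)).symm
      rw [← add_assoc, Nat.cast_succ]
      exact Order.add_one_le_of_lt (ih.trans_lt hlt)
  lift b to ℕ using hb
  have := (key (b + 1)).trans (hd _)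
  norm_cast at this
  omega

/-- Over a local ring with infinite residue field, an ideal primary to the maximal ideal has a
principal reduction, provided that the maximal ideal contains a nonzerodivisor generating an
ideal of finite colength. -/
theorem exists_reduction [IsLocalRing R] [IsNoetherianRing R] [Infinite (ResidueField R)]
    {x : R} (hx : x ∈ maximalIdeal R) (hreg : x ∈ R⁰) {k : ℕ}
    (hk : maximalIdeal R ^ k ≤ Ideal.span {x}) {I : Ideal R} {j : ℕ}
    (hI : maximalIdeal R ^ j ≤ I) : ∃ a ∈ I, ∃ r, I ^ (r + 1) = Ideal.span {a} * I ^ r := by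
  obtain ⟨a, ha, n₀, hn₀⟩ := exists_mem_eventually_mul_mem I
  refine ⟨a, ha, ?_⟩
  let m := maximalIdeal R
  -- Multiplication by `a` embeds `Iⁿ / 𝔪Iⁿ` into `Iⁿ⁺¹ / 𝔪Iⁿ⁺¹`, with image `(aIⁿ + 𝔪Iⁿ⁺¹) /
  -- 𝔪Iⁿ⁺¹`.
  have hstep : ∀ n ≥ n₀, quotLen (m * I ^ n) (I ^ n) ≤
      quotLen (m * I ^ (n + 1)) (Ideal.span {a} * I ^ n ⊔ m * I ^ (n + 1)) := by
    intro n hn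
    refine quotLen_le_of_map (LinearMap.mulLeft R a) (fun z hz => ?_) fun z hz => ⟨hn₀ n hn z hz, ?_⟩
    · exact Ideal.mem_sup_left (Ideal.mul_mem_mul (Ideal.mem_span_singleton_self a) hz)
    · intro h
      have := Ideal.mul_mem_mul ha h
      change a * z ∈ m * I ^ (n + 1)
      rwa [mul_left_comm, ← pow_succ'] at this
  have hle : ∀ n, Ideal.span {a} * I ^ n ⊔ m * I ^ (n + 1) ≤ I ^ (n + 1) := by
    intro n
    refine sup_le ?_ Ideal.mul_le_right
    rw [pow_succ']
    exact Ideal.mul_mono_left (by simpa [Ideal.span_le] using ha)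
  have hbfin : quotLen (Ideal.span {x}) (⊤ : Ideal R) ≠ ⊤ :=
    quotLen_ne_top (IsNoetherian.noetherian _) (k := k) (by simpa using hk)
  have hbd : ∀ n, quotLen (m * I ^ n) (I ^ n) ≤ quotLen (Ideal.span {x}) (⊤ : Ideal R) := fun n =>
    quotLen_mul_le hx hreg (j := j * n) (by
      rw [pow_mul]
      exact Ideal.pow_right_mono hI n)
  -- The numbers of generators of `Iⁿ` are eventually nondecreasing and bounded, so two consecutive
  -- ones agree and the embedding is onto. Nakayama then removes `𝔪Iⁿ⁺¹`.
  obtain ⟨n, hn, heq⟩ := exists_eq_succ_of_bounded hbfin hbd (n₀ := n₀)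
    fun n hn => (hstep n hn).trans (quotLen_mono (hle n))
  refine ⟨n, le_antisymm ?_ (le_sup_left.trans (hle n))⟩
  have hsum := quotLen_add (le_sup_right : m * I ^ (n + 1) ≤ _) (hle n)
  have h0 : quotLen (Ideal.span {a} * I ^ n ⊔ m * I ^ (n + 1)) (I ^ (n + 1)) = 0 := by
    have h1 := heq ▸ hstep n hn
    have h2 : quotLen (m * I ^ (n + 1)) (Ideal.span {a} * I ^ n ⊔ m * I ^ (n + 1)) =
        quotLen (m * I ^ (n + 1)) (I ^ (n + 1)) := le_antisymm (quotLen_mono (hle n)) h1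
    rw [h2] at hsum
    have hfin := ne_top_of_le_ne_top hbfin (hbd (n + 1))
    nth_rewrite 2 [← add_zero (quotLen (m * I ^ (n + 1)) (I ^ (n + 1)))] at hsum
    exact (ENat.add_right_injective_of_ne_top hfin).eq_iff.1 hsum
  refine Submodule.le_of_le_smul_of_le_jacobson_bot (I := m) (IsNoetherian.noetherian _)
    (maximalIdeal_le_jacobson _) ?_
  exact quotLen_eq_zero_iff.1 h0

end Reduction

/-! ### The blowup `a⁻ʳ Iʳ P` and the length formula. -/

section Blowup

variable {R : Type u} [CommRing R] {X : Type*} [AddCommGroup X] [Module R X]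

/-- The submodule `a⁻ʳ Iʳ P` of a module on which `a` acts bijectively. -/
def blowup (I : Ideal R) (a : R) (r : ℕ) (P : Submodule R X) : Submodule R X :=
  Submodule.comap (LinearMap.lsmul R X (a ^ r)) (I ^ r • P)

variable {I : Ideal R} {a : R} {r : ℕ} {P : Submodule R X}

theorem mem_blowup {x : X} : x ∈ blowup I a r P ↔ a ^ r • x ∈ I ^ r • P := Iff.rfl

theorem bijective_pow_smul (ha : Function.Bijective fun x : X => a • x) (n : ℕ) :
    Function.Bijective (LinearMap.lsmul R X (a ^ n)) := by
  induction n with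
  | zero =>
    convert Function.bijective_id (α := X) using 1
    ext x
    simp
  | succ n ih =>
    have : ⇑(LinearMap.lsmul R X (a ^ (n + 1))) =
        (LinearMap.lsmul R X (a ^ n)) ∘ fun x : X => a • x := by
      ext x
      simpa [pow_succ, mul_smul] using smul_comm _ _ _
    rw [this]
    exact ih.comp ha

theorem map_lsmul (c : R) (P : Submodule R X) :
    Submodule.map (LinearMap.lsmul R X c) P = Ideal.span {c} • P := by
  rw [Submodule.ideal_span_singleton_smul]
  rfl

theorem pow_add_eq_of_reduction (h : I ^ (r + 1) = Ideal.span {a} * I ^ r) (k : ℕ) :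
    I ^ (r + k) = Ideal.span {a ^ k} * I ^ r := by
  induction k with
  | zero => simp
  | succ k ih =>
    rw [← add_assoc, pow_succ, ih, mul_assoc, ← pow_succ, h, ← mul_assoc,
      Ideal.span_singleton_mul_span_singleton, ← pow_succ]

/-- The reduction equation gives `Iⁿ = aⁿ⁻ʳ Iʳ` for `n ≥ r`, so the blowup is also `a⁻ⁿ Iⁿ P` for
every such `n`. -/
theorem map_blowup (ha : Function.Bijective fun x : X => a • x)
    (h : I ^ (r + 1) = Ideal.span {a} * I ^ r) {n : ℕ} (hn : r ≤ n) :
    Submodule.map (LinearMap.lsmul R X (a ^ n)) (blowup I a r P) = I ^ n • P := by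
  obtain ⟨k, rfl⟩ := Nat.exists_eq_add_of_le hn
  have hr : Submodule.map (LinearMap.lsmul R X (a ^ r)) (blowup I a r P) = I ^ r • P :=
    Submodule.map_comap_eq_of_surjective (bijective_pow_smul ha r).2 _
  rw [map_lsmul] at hr ⊢
  rw [pow_add, mul_comm, ← Ideal.span_singleton_mul_span_singleton, mul_smul, hr, ← mul_smul,
    pow_add_eq_of_reduction h]

theorem le_blowup (haI : a ∈ I) : P ≤ blowup I a r P := fun _ hx =>
  Submodule.smul_mem_smul (Ideal.pow_mem_pow haI r) hx

theorem blowup_fg [IsNoetherianRing R] (ha : Function.Bijective fun x : X => a • x) (hP : P.FG) :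
    (blowup I a r P).FG := by
  refine Submodule.fg_of_fg_map_injective _ (bijective_pow_smul ha r).1 ?_
  rw [blowup, Submodule.map_comap_eq_of_surjective (bijective_pow_smul ha r).2]
  exact Submodule.FG.smul (IsNoetherian.noetherian (I ^ r)) hP

theorem quotLen_pow_smul (ha : Function.Bijective fun x : X => a • x) (n : ℕ) :
    quotLen (Submodule.map (LinearMap.lsmul R X (a ^ n)) P) P =
      n * quotLen (Submodule.map (LinearMap.lsmul R X a) P) P := by
  have hle : ∀ c : R, Submodule.map (LinearMap.lsmul R X c) P ≤ P := by
    rintro c _ ⟨x, hx, rfl⟩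
    exact P.smul_mem c hx
  induction n with
  | zero =>
    rw [Nat.cast_zero, zero_mul, quotLen_eq_zero_iff]
    intro x hx
    exact ⟨x, hx, by simp⟩
  | succ n ih =>
    have hs : Submodule.map (LinearMap.lsmul R X (a ^ (n + 1))) P =
        Submodule.map (LinearMap.lsmul R X (a ^ n))
          (Submodule.map (LinearMap.lsmul R X a) P) := by
      simp only [map_lsmul]
      rw [← mul_smul, Ideal.span_singleton_mul_span_singleton, pow_succ]
    rw [hs, ← quotLen_add (Submodule.map_mono (hle a)) (hle _),
      quotLen_map_map (bijective_pow_smul ha n).1, ih, Nat.cast_succ, add_mul, one_mul, add_comm]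

/-- Split `aⁿ P ⊆ Iⁿ P ⊆ P`: the lower quotient is `aⁿ P' / aⁿ P ≅ P' / P` for the blowup `P'`, and
`P / aⁿ P` has `n` layers isomorphic to `P / aP`. -/
theorem quotLen_pow_smul_add (ha : Function.Bijective fun x : X => a • x) (haI : a ∈ I)
    (h : I ^ (r + 1) = Ideal.span {a} * I ^ r) {n : ℕ} (hn : r ≤ n) :
    quotLen (I ^ n • P) P + quotLen P (blowup I a r P) =
      n * quotLen (Submodule.map (LinearMap.lsmul R X a) P) P := by
  rw [← quotLen_pow_smul ha, ← map_blowup ha h hn (P := P), add_comm,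
    ← quotLen_map_map (bijective_pow_smul ha n).1 P]
  refine quotLen_add (Submodule.map_mono (le_blowup haI)) ?_
  rw [map_blowup ha h hn]
  exact Submodule.smul_le_right

end Blowup

/-- For `r = 1` the Hilbert sum is `e₀ n - e₁`, so `e₁ = l - c`. The constant `c` is `0` for modules
and `ℓ(R / K)` for the relative function; additive form avoids subtraction in `ℕ∞`. -/
theorem isHilbertCoeffs_one {f : ℕ → ℕ∞} {e l c n₀ : ℕ}
    (h : ∀ n ≥ n₀, f n + l = n * e + c) :
    IsHilbertCoeffs f 1 (fun i => if i = 0 then (e : ℤ) else l - c) := by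
  refine eventually_atTop.2 ⟨n₀, fun n hn => ?_⟩
  have hn' := h n hn
  have hfin : f n ≠ ⊤ := by
    intro ht
    rw [ht, top_add] at hn'
    exact ENat.natCast_ne_top (n * e + c) (by push_cast; exact hn'.symm)
  lift f n to ℕ using hfin with m hm
  refine ⟨m, rfl, ?_⟩
  norm_cast at hn'
  simp [hilbertSum, Finset.sum_range_succ]
  zify at hn'
  linarith

theorem mem_nonZeroDivisors_of_isSMulRegular {R : Type*} [CommRing R] {a : R} (h : IsSMulRegular R a) : a ∈ R⁰ := by
  rw [mem_nonZeroDivisors_iff_right]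
  intro z hz
  refine h ?_
  simpa [mul_comm] using hz

/-! ### Regular elements and finite colength in dimension one. -/

section Regular

variable {R : Type u} [CommRing R] [IsLocalRing R] {M : Type v} [AddCommGroup M] [Module R M]

theorem exists_isSMulRegular_of_depth_pos (h : depth R M ≠ 0) :
    ∃ x ∈ maximalIdeal R, IsSMulRegular M x := by
  by_contra! hcon
  apply h
  rw [depth, ← bot_eq_zero, iSup_eq_bot]
  intro rs
  rw [iSup_eq_bot]
  rintro ⟨hm, hreg⟩
  cases rs with
  | nil => simp
  | cons x l =>
    exact absurd ((RingTheory.Sequence.isRegular_cons_iff M x l).1 hreg).1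
      (hcon x (hm x (by simp)))

theorem isSMulRegular_of_pow_le {x a : R} (hx : x ∈ maximalIdeal R) (hreg : IsSMulRegular M x)
    {k : ℕ} (hk : maximalIdeal R ^ k ≤ Ideal.span {a}) : IsSMulRegular M a := by
  obtain ⟨c, hc⟩ := Ideal.mem_span_singleton'.1 (hk (Ideal.pow_mem_pow hx k))
  exact IsSMulRegular.of_mul (hc ▸ hreg.pow k)

theorem exists_pow_le_span_singleton [IsNoetherianRing R] (hdim : ringKrullDim R = 1) {s : R}
    (hs : s ∈ R⁰) : ∃ k, maximalIdeal R ^ k ≤ Ideal.span {s} := by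
  have : Ring.KrullDimLE 1 R := by
    rw [Ring.KrullDimLE, Order.krullDimLE_iff]
    exact hdim.le
  have : IsArtinianRing (R ⧸ Ideal.span {s}) := by
    have h := (isFiniteLength_iff_isNoetherian_isArtinian.1
      (isFiniteLength_quotient_span_singleton R hs)).2
    exact isArtinian_of_tower R h
  exact exists_maximalIdeal_pow_le_of_isArtinianRing_quotient _

theorem exists_pow_le_of_reduction {I : Ideal R} {a : R} {r j : ℕ} (hI : maximalIdeal R ^ j ≤ I)
    (h : I ^ (r + 1) = Ideal.span {a} * I ^ r) : ∃ k, maximalIdeal R ^ k ≤ Ideal.span {a} := by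
  refine ⟨j * (r + 1), ?_⟩
  rw [pow_mul]
  exact (Ideal.pow_right_mono hI _).trans (h.le.trans Ideal.mul_le_left)

theorem IsMPrimary.exists_pow_le [IsNoetherianRing R] {I : Ideal R} (hI : IsMPrimary I) :
    ∃ j, maximalIdeal R ^ j ≤ I :=
  Ideal.exists_pow_le_of_le_radical_of_fg hI.2.ge (IsNoetherian.noetherian _)

theorem isMPrimary_of_pow_le {I : Ideal R} {j : ℕ} (hI : maximalIdeal R ^ j ≤ I)
    (hm : I ≤ maximalIdeal R) : IsMPrimary I := by
  have hr : I.radical = maximalIdeal R :=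
    le_antisymm ((maximalIdeal.isMaximal R).isPrime.radical_le_iff.2 hm)
      fun x hx => ⟨j, hI (Ideal.pow_mem_pow hx j)⟩
  refine ⟨Ideal.isPrimary_of_isMaximal_radical ?_, hr⟩
  rw [hr]
  infer_instance

end Regular

/-! ### Finiteness of the lengths, and reductions of `𝔪`-primary ideals. -/

section Coefficients

variable {R : Type u} [CommRing R] [IsLocalRing R] [IsNoetherianRing R]

theorem exists_nat_quotLen_add {X : Type*} [AddCommGroup X] [Module R X] {P : Submodule R X}
    {I : Ideal R} {a : R} {r k : ℕ} (ha : Function.Bijective fun x : X => a • x) (haI : a ∈ I)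
    (h : I ^ (r + 1) = Ideal.span {a} * I ^ r) (hk : maximalIdeal R ^ k ≤ Ideal.span {a})
    (hP : P.FG) : ∃ e l : ℕ, quotLen P (blowup I a r P) = l ∧
      ∀ n ≥ r, quotLen (I ^ n • P) P + l = n * e := by
  have hfin : quotLen (Submodule.map (LinearMap.lsmul R X a) P) P ≠ ⊤ :=
    quotLen_ne_top hP (k := k) (by rw [map_lsmul]; exact Submodule.smul_mono_left hk)
  have hadd := fun n (hn : r ≤ n) => quotLen_pow_smul_add ha haI h hn (P := P)
  lift quotLen (Submodule.map (LinearMap.lsmul R X a) P) P to ℕ using hfin with e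
  -- The length formula at `n = r` has a finite right-hand side.
  have hl : quotLen P (blowup I a r P) ≠ ⊤ := by
    intro ht
    have := hadd r le_rfl
    rw [ht, add_top] at this
    exact ENat.natCast_ne_top (r * e) (by push_cast; exact this.symm)
  lift quotLen P (blowup I a r P) to ℕ using hl with l
  exact ⟨e, l, rfl, hadd⟩

theorem exists_reduction_of_isMPrimary (hR : depth R R ≠ 0) (hdim : ringKrullDim R = 1)
    [Infinite (ResidueField R)] {I : Ideal R} (hI : IsMPrimary I) :
    ∃ a ∈ I, a ∈ R⁰ ∧ ∃ r k, I ^ (r + 1) = Ideal.span {a} * I ^ r ∧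
      maximalIdeal R ^ k ≤ Ideal.span {a} := by
  obtain ⟨x, hx, hreg⟩ := exists_isSMulRegular_of_depth_pos hR
  have hx0 := mem_nonZeroDivisors_of_isSMulRegular hreg
  obtain ⟨k, hk⟩ := exists_pow_le_span_singleton hdim hx0
  obtain ⟨j, hj⟩ := hI.exists_pow_le
  obtain ⟨a, ha, r, hr⟩ := exists_reduction hx hx0 hk hj
  obtain ⟨k, hk⟩ := exists_pow_le_of_reduction hj hr
  exact ⟨a, ha, mem_nonZeroDivisors_of_isSMulRegular (isSMulRegular_of_pow_le hx hreg hk), r, k,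
    hr, hk⟩

end Coefficients

/-! ### Translation to extended real numbers. -/

section EReal

variable {R : Type u} [CommRing R]

theorem relLength_eq_quotLen {X : Type v} [AddCommGroup X] [Module R X] (P N : Submodule R X) :
    relLength R P N = ((quotLen P N : ℝ≥0∞) : EReal) := rfl

theorem coe_natCast_eq_intE (l : ℕ) : (((l : ℕ∞) : ℝ≥0∞) : EReal) = intE l := by
  rw [intE, ENat.toENNReal_coe, Int.cast_natCast, EReal.coe_coe_eq_natCast]
  rfl

theorem relLength_of_quotLen_eq {X : Type v} [AddCommGroup X] [Module R X] {P N : Submodule R X}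
    {l : ℕ} (h : quotLen P N = l) : relLength R P N = intE l := by
  rw [relLength_eq_quotLen, h, coe_natCast_eq_intE]

theorem lengthE_of_length_eq {X : Type v} [AddCommGroup X] [Module R X] {l : ℕ}
    (h : Module.length R X = l) : lengthE R X = intE l := by
  rw [lengthE, h, coe_natCast_eq_intE]

theorem intE_sub (c d : ℤ) : intE (c - d) = intE c - intE d := by
  simp [intE, EReal.coe_sub]

theorem relLength_mono {X : Type v} [AddCommGroup X] [Module R X] {P N N' : Submodule R X}
    (h : N ≤ N') : relLength R P N ≤ relLength R P N' := by
  rw [relLength_eq_quotLen, relLength_eq_quotLen]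
  exact_mod_cast quotLen_mono h

theorem dimNat_eq_one {M : Type v} [AddCommGroup M] [Module R M]
    (h : Module.supportDim R M = 1) : dimNat R M = 1 := by
  rw [dimNat, h]
  rfl

end EReal

/-! ### Maximal Cohen–Macaulay modules. -/

section ModuleCase

variable {R : Type u} [CommRing R] {M : Type v} [AddCommGroup M] [Module R M]

theorem injective_mkLinearMap (h : ∀ s ∈ R⁰, IsSMulRegular M s) :
    Function.Injective (LocalizedModule.mkLinearMap R⁰ M) := by
  rw [IsLocalizedModule.injective_iff_isRegular R⁰]
  exact fun s => h s s.2

theorem bijective_smul_localizedModule {a : R} (ha : a ∈ R⁰) :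
    Function.Bijective fun x : LocalizedModule R⁰ M => a • x :=
  (Module.End.isUnit_iff _).1
    (IsLocalizedModule.map_units (LocalizedModule.mkLinearMap R⁰ M) ⟨a, ha⟩)

theorem hilbertSamuel_eq_quotLen (hinj : Function.Injective (LocalizedModule.mkLinearMap R⁰ M))
    (I : Ideal R) (n : ℕ) : hilbertSamuel I M n =
      quotLen (I ^ n • imageInLocalization R M) (imageInLocalization R M) := by
  rw [imageInLocalization, ← Submodule.map_top, ← Submodule.map_smul'', quotLen_map_map hinj,
    quotLen_top]
  rfl

variable [IsLocalRing R]

/-- Some `M`-regular `x ∈ 𝔪` has a power divisible by `s`, since `R / sR` has finite length; a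
divisor of an `M`-regular element is `M`-regular. -/
theorem isSMulRegular_of_mem_nonZeroDivisors [IsNoetherianRing R] (hdim : ringKrullDim R = 1)
    (hM : depth R M ≠ 0) {s : R} (hs : s ∈ R⁰) : IsSMulRegular M s := by
  obtain ⟨x, hx, hreg⟩ := exists_isSMulRegular_of_depth_pos hM
  obtain ⟨k, hk⟩ := exists_pow_le_span_singleton hdim hs
  exact isSMulRegular_of_pow_le hx hreg hk

theorem hilbertSamuel_of_isMPrimary [IsNoetherianRing R] (hR : depth R R ≠ 0)
    (hdim : ringKrullDim R = 1) [Infinite (ResidueField R)]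
    (hinj : Function.Injective (LocalizedModule.mkLinearMap R⁰ M)) [Module.Finite R M]
    (hMdim : Module.supportDim R M = 1) {I : Ideal R} (hI : IsMPrimary I) :
    HasHilbertPolynomial (hilbertSamuel I M) 1 ∧
      ∃ N : Submodule R (LocalizedModule R⁰ M), imageInLocalization R M ≤ N ∧ N.FG ∧
        intE (eCoeff 1 I M) = relLength R (imageInLocalization R M) N := by
  obtain ⟨a, haI, ha0, r, k, hr, hk⟩ := exists_reduction_of_isMPrimary hR hdim hI
  have ha := bijective_smul_localizedModule (M := M) ha0
  have hfg : (imageInLocalization R M).FG := by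
    rw [imageInLocalization, ← Submodule.map_top]
    exact Module.Finite.fg_top.map _
  obtain ⟨e, l, hl, hadd⟩ := exists_nat_quotLen_add ha haI hr hk hfg
  have hc : IsHilbertCoeffs (hilbertSamuel I M) 1 _ :=
    isHilbertCoeffs_one (e := e) (l := l) (c := 0) (n₀ := r) fun n hn => by
      rw [hilbertSamuel_eq_quotLen hinj, hadd n hn, Nat.cast_zero, add_zero]
  refine ⟨⟨_, hc⟩, blowup I a r (imageInLocalization R M), le_blowup haI, blowup_fg ha hfg, ?_⟩
  rw [relLength_of_quotLen_eq hl, eCoeff, dimNat_eq_one hMdim, coeff_eq hc le_rfl]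
  simp

end ModuleCase

/-! ### Finite subalgebras as blowup algebras. -/

section RingCase

variable {R : Type u} [CommRing R]

theorem bijective_smul_fractionRing {a : R} (ha : a ∈ R⁰) :
    Function.Bijective fun x : FractionRing R => a • x := by
  have h := IsLocalization.map_units (FractionRing R) (⟨a, ha⟩ : R⁰)
  have he : (fun x : FractionRing R => a • x) = fun x => algebraMap R (FractionRing R) a * x := by
    ext x
    exact Algebra.smul_def a x
  rw [he]
  exact IsUnit.isUnit_iff_mulLeft_bijective.1 h

theorem idealImage_eq_smul (J : Ideal R) :
    idealImage J = J • (1 : Submodule R (FractionRing R)) := by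
  rw [idealImage, Submodule.one_eq_range, ← Submodule.map_top, ← Submodule.map_smul'']
  simp

theorem mem_idealImage {J : Ideal R} {x : FractionRing R} :
    x ∈ idealImage J ↔ ∃ j ∈ J, algebraMap R (FractionRing R) j = x := Iff.rfl

theorem idealImage_mul (I J : Ideal R) : idealImage (I * J) = I • idealImage J := by
  rw [idealImage_eq_smul, idealImage_eq_smul, mul_smul]

theorem injective_linearMap : Function.Injective (Algebra.linearMap R (FractionRing R)) :=
  IsFractionRing.injective R (FractionRing R)

theorem hilbertRel_eq_quotLen (K I : Ideal R) (n : ℕ) :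
    hilbertRel K I n = quotLen (I ^ n • idealImage K) (idealImage K) +
      Module.length R (R ⧸ K) := by
  rw [← idealImage_mul, idealImage, idealImage, quotLen_map_map injective_linearMap, mul_comm,
    ← quotLen_top K, quotLen_add Ideal.mul_le_left le_top, quotLen_top]
  rfl

/-- The blowup algebra `R[I/a] = a⁻ʳ Iʳ` of an ideal with reduction `a`. -/
noncomputable def blowupAlgebra {I : Ideal R} {a : R} {r : ℕ} (ha : a ∈ R⁰) (haI : a ∈ I)
    (h : I ^ (r + 1) = Ideal.span {a} * I ^ r) : Subalgebra R (FractionRing R) :=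
  (blowup I a r (1 : Submodule R (FractionRing R))).toSubalgebra
    (le_blowup haI (Submodule.mem_one.2 ⟨1, map_one _⟩)) fun x y hx hy => by
      rw [mem_blowup, ← idealImage_eq_smul] at hx hy
      obtain ⟨i, hi, hx⟩ := hx
      obtain ⟨j, hj, hy⟩ := hy
      have hmem : a ^ (r + r) • (x * y) ∈ I ^ (r + r) • (1 : Submodule R (FractionRing R)) := by
        rw [← idealImage_eq_smul]
        refine ⟨i * j, by rw [pow_add]; exact Ideal.mul_mem_mul hi hj, ?_⟩
        rw [pow_add, ← smul_mul_smul_comm, ← hx, ← hy]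
        simp
      have hb := bijective_smul_fractionRing ha
      -- The product lies in `a⁻²ʳ I²ʳ`, which is the same blowup.
      rw [← map_blowup hb h (Nat.le_add_left r r)] at hmem
      obtain ⟨z, hz, hzx⟩ := hmem
      rwa [← (bijective_pow_smul hb (r + r)).1 hzx]

theorem toSubmodule_blowupAlgebra {I : Ideal R} {a : R} {r : ℕ} (ha : a ∈ R⁰) (haI : a ∈ I)
    (h : I ^ (r + 1) = Ideal.span {a} * I ^ r) :
    Subalgebra.toSubmodule (blowupAlgebra ha haI h) = blowup I a r 1 := by
  simp [blowupAlgebra]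

theorem smul_blowup {X : Type*} [AddCommGroup X] [Module R X] {I : Ideal R} {a : R} {r : ℕ}
    (ha : Function.Bijective fun x : X => a • x) (K : Ideal R) (P : Submodule R X) :
    K • blowup I a r P = blowup I a r (K • P) := by
  apply Submodule.map_injective_of_injective (bijective_pow_smul ha r).1
  rw [Submodule.map_smul'', blowup, blowup,
    Submodule.map_comap_eq_of_surjective (bijective_pow_smul ha r).2,
    Submodule.map_comap_eq_of_surjective (bijective_pow_smul ha r).2, ← mul_smul, ← mul_smul,
    mul_comm]

theorem extend_eq_blowup {I : Ideal R} {a : R} {r : ℕ} (ha : a ∈ R⁰) (K : Ideal R)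
    {B : Subalgebra R (FractionRing R)} (hB : Subalgebra.toSubmodule B = blowup I a r 1) :
    extend K B = blowup I a r (idealImage K) := by
  rw [extend, hB, smul_blowup (bijective_smul_fractionRing ha), idealImage_eq_smul]

theorem le_integralClosure_of_finite {A : Type*} [CommRing A] [Algebra R A] (B : Subalgebra R A)
    [Module.Finite R B] : B ≤ integralClosure R A := fun x hx =>
  (IsIntegral.of_finite R (⟨x, hx⟩ : B)).map B.val

theorem exists_smul_mem_one (B : Subalgebra R (FractionRing R)) [Module.Finite R B] :
    ∃ s ∈ R⁰, ∀ b ∈ B, s • b ∈ (1 : Submodule R (FractionRing R)) := by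
  obtain ⟨t, ht⟩ : (Subalgebra.toSubmodule B).FG := Module.Finite.iff_fg.1 ‹_›
  obtain ⟨s, hs⟩ := IsLocalization.exist_integer_multiples_of_finset R⁰ t
  refine ⟨s, s.2, fun b hb => ?_⟩
  have hle : Subalgebra.toSubmodule B ≤
      Submodule.comap (LinearMap.lsmul R _ (s : R)) (1 : Submodule R (FractionRing R)) := by
    rw [← ht, Submodule.span_le]
    intro x hx
    obtain ⟨c, hc⟩ := hs x hx
    exact Submodule.mem_one.2 ⟨c, hc⟩
  exact hle hb

variable [IsLocalRing R] [IsNoetherianRing R]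

theorem hilbertRel_of_reduction (hdim : ringKrullDim R = 1) {K I : Ideal R} (hK : IsMPrimary K)
    {a : R} (ha : a ∈ R⁰) (haI : a ∈ I) {r k : ℕ} (h : I ^ (r + 1) = Ideal.span {a} * I ^ r)
    (hk : maximalIdeal R ^ k ≤ Ideal.span {a}) {B : Subalgebra R (FractionRing R)}
    (hB : Subalgebra.toSubmodule B = blowup I a r 1) :
    HasHilbertPolynomial (hilbertRel K I) 1 ∧ ∃ l q : ℕ,
      quotLen (idealImage K) (extend K B) = l ∧ Module.length R (R ⧸ K) = q ∧
      gCoeff 1 K I = l - q := by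
  have hb := bijective_smul_fractionRing ha
  have hfg : (idealImage K).FG := (IsNoetherian.noetherian K).map _
  obtain ⟨e, l, hl, hadd⟩ := exists_nat_quotLen_add hb haI h hk hfg
  obtain ⟨j, hj⟩ := hK.exists_pow_le
  have hq : Module.length R (R ⧸ K) ≠ ⊤ := by
    rw [← quotLen_top]
    exact quotLen_ne_top (IsNoetherian.noetherian _) (k := j) (by simpa using hj)
  obtain ⟨q, hq⟩ := ENat.ne_top_iff_exists.1 hq
  have hc : IsHilbertCoeffs (hilbertRel K I) 1 _ :=
    isHilbertCoeffs_one (e := e) (l := l) (c := q) (n₀ := r) fun n hn => by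
      rw [hilbertRel_eq_quotLen, ← hq, ← hadd n hn, add_right_comm]
  refine ⟨⟨_, hc⟩, l, q, by rw [extend_eq_blowup ha K hB, hl], hq.symm, ?_⟩
  rw [gCoeff, dimNat_eq_one ((Module.supportDim_self_eq_ringKrullDim R).trans hdim),
    coeff_eq hc le_rfl]
  simp

/-- Every finite subalgebra of the total ring of fractions is the blowup algebra of an
`𝔪`-primary ideal. -/
theorem exists_isMPrimary_blowup_eq (hR : depth R R ≠ 0) (hdim : ringKrullDim R = 1)
    (B : Subalgebra R (FractionRing R)) [Module.Finite R B] :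
    ∃ I : Ideal R, IsMPrimary I ∧ ∃ a ∈ I, a ∈ R⁰ ∧ ∃ r k, I ^ (r + 1) = Ideal.span {a} * I ^ r ∧
      maximalIdeal R ^ k ≤ Ideal.span {a} ∧ Subalgebra.toSubmodule B = blowup I a r 1 := by
  obtain ⟨x, hx, hreg⟩ := exists_isSMulRegular_of_depth_pos hR
  obtain ⟨s, hs, hsB⟩ := exists_smul_mem_one B
  -- The factor `s` clears denominators of `B`; the extra factor `x ∈ 𝔪` forces `aB ⊆ 𝔪`, so that
  -- the ideal is proper.
  have ha : x * s ∈ R⁰ := mul_mem (mem_nonZeroDivisors_of_isSMulRegular hreg) hs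
  obtain ⟨k, hk⟩ := exists_pow_le_span_singleton hdim ha
  have hinj := IsFractionRing.injective R (FractionRing R)
  set a := x * s with ha'
  let I : Ideal R := Submodule.comap (Algebra.linearMap R (FractionRing R))
    (Submodule.map (LinearMap.lsmul R _ a) (Subalgebra.toSubmodule B))
  have hmem : ∀ c : R, c ∈ I ↔ ∃ b ∈ B, a • b = algebraMap R (FractionRing R) c := fun c => Iff.rfl
  have hlift : ∀ b ∈ B, ∃ c ∈ maximalIdeal R, c ∈ I ∧ algebraMap R (FractionRing R) c = a • b := by
    intro b hb
    obtain ⟨c, hc⟩ := Submodule.mem_one.1 (hsB b hb)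
    have hxc : algebraMap R (FractionRing R) (x * c) = a • b := by
      rw [map_mul, hc, ← Algebra.smul_def, ha', mul_smul]
    exact ⟨x * c, Ideal.mul_mem_right _ _ hx, (hmem _).2 ⟨b, hb, hxc.symm⟩, hxc⟩
  have haI : a ∈ I := (hmem a).2 ⟨1, B.one_mem, by rw [Algebra.algebraMap_eq_smul_one]⟩
  have hspan : Ideal.span {a} ≤ I := by simpa [Ideal.span_le] using haI
  have hIm : I ≤ maximalIdeal R := by
    intro c hc
    obtain ⟨b, hb, h⟩ := (hmem c).1 hc
    obtain ⟨d, hd, -, h'⟩ := hlift b hb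
    rwa [hinj (h.symm.trans h'.symm)]
  -- Since `I` is `aB` and `B` is a ring, `I² = a · aB = aI`: the reduction exponent is `1`.
  have hred : I ^ (1 + 1) = Ideal.span {a} * I ^ 1 := by
    rw [pow_succ, pow_one]
    refine le_antisymm (Ideal.mul_le.2 fun i hi j hj => ?_) (Ideal.mul_mono_left hspan)
    obtain ⟨b, hb, h⟩ := (hmem i).1 hi
    obtain ⟨b', hb', h'⟩ := (hmem j).1 hj
    obtain ⟨c, -, hcI, hc⟩ := hlift _ (B.mul_mem hb hb')
    have : i * j = a * c := by
      apply hinj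
      rw [map_mul, map_mul, hc, ← h, ← h', ← Algebra.smul_def, smul_mul_smul_comm, mul_smul]
    rw [this]
    exact Ideal.mul_mem_mul (Ideal.mem_span_singleton_self a) hcI
  refine ⟨I, isMPrimary_of_pow_le (hk.trans hspan) hIm, a, haI, ha, 1, k, hred, hk, ?_⟩
  ext y
  rw [mem_blowup, ← idealImage_eq_smul, pow_one, pow_one, mem_idealImage]
  constructor
  · intro hy
    obtain ⟨c, -, hcI, hc⟩ := hlift y hy
    exact ⟨c, hcI, hc⟩
  · rintro ⟨c, hcI, hc⟩
    obtain ⟨b, hb, h⟩ := (hmem c).1 hcI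
    rw [← (bijective_smul_fractionRing ha).1 (h.trans hc)]
    exact hb

end RingCase

/-! ### Passing to the integral closure. -/

section Supremum

variable {R : Type u} [CommRing R]

theorem extend_mono (K : Ideal R) {B B' : Subalgebra R (FractionRing R)} (h : B ≤ B') :
    extend K B ≤ extend K B' :=
  smul_mono_right K (Subalgebra.toSubmodule.monotone h)

theorem finite_blowupAlgebra [IsNoetherianRing R] {I : Ideal R} {a : R} {r : ℕ} (ha : a ∈ R⁰)
    (haI : a ∈ I) (h : I ^ (r + 1) = Ideal.span {a} * I ^ r) :
    Module.Finite R (blowupAlgebra ha haI h) := by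
  refine Module.Finite.iff_fg.2 (?_ : (Subalgebra.toSubmodule (blowupAlgebra ha haI h)).FG)
  rw [toSubmodule_blowupAlgebra]
  refine blowup_fg (bijective_smul_fractionRing ha) ?_
  rw [Submodule.one_eq_span]
  exact Submodule.fg_span_singleton 1

/-- If the lengths of `KB / K` are maximal at the finite subalgebra `B`, then `KB` is the extension
of `K` to the integral closure. -/
theorem extend_integralClosure_le {K : Ideal R} {B : Subalgebra R (FractionRing R)}
    [Module.Finite R B] (hfin : quotLen (idealImage K) (extend K B) ≠ ⊤)
    (hmax : ∀ B' : Subalgebra R (FractionRing R), Module.Finite R B' →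
      quotLen (idealImage K) (extend K B') ≤ quotLen (idealImage K) (extend K B)) :
    extend K (integralClosure R (FractionRing R)) ≤ extend K B := by
  refine Submodule.smul_le.2 fun c hc x hx => ?_
  have hfx : Module.Finite R (Algebra.adjoin R {x}) :=
    Algebra.finite_adjoin_simple_of_isIntegral hx
  let B' := B ⊔ Algebra.adjoin R {x}
  have hB' : Module.Finite R B' := Subalgebra.finite_sup B _
  have hle : extend K B ≤ extend K B' := extend_mono K le_sup_left
  have hadd := quotLen_add (idealImage_le_extend K B) hle
  -- `B' = B[x]` is again finite, so maximality and additivity of finite lengths force `KB' = KB`.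
  have h0 : quotLen (extend K B) (extend K B') = 0 := by
    have h1 := le_antisymm (hadd.le.trans (hmax B' hB')) le_self_add
    nth_rewrite 2 [← add_zero (quotLen (idealImage K) (extend K B))] at h1
    exact (ENat.add_right_injective_of_ne_top hfin).eq_iff.1 h1
  exact quotLen_eq_zero_iff.1 h0 (Submodule.smul_mem_smul hc
    ((le_sup_right : _ ≤ B') (Algebra.self_mem_adjoin_singleton R x)))

theorem relLength_sub_lengthE {K : Ideal R} {B : Subalgebra R (FractionRing R)} {l q : ℕ}
    (hl : quotLen (idealImage K) (extend K B) = l) (hq : Module.length R (R ⧸ K) = q) :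
    relLength R (idealImage K) (extend K B) - lengthE R (R ⧸ K) = intE (l - q) := by
  rw [relLength_of_quotLen_eq hl, lengthE_of_length_eq hq, intE_sub]

variable [IsLocalRing R] [IsNoetherianRing R]

theorem exists_quotLen_extend_eq (hR : depth R R ≠ 0) (hdim : ringKrullDim R = 1) {K : Ideal R}
    (hK : IsMPrimary K) (B : Subalgebra R (FractionRing R)) [Module.Finite R B] :
    ∃ l q : ℕ, quotLen (idealImage K) (extend K B) = l ∧ Module.length R (R ⧸ K) = q ∧
      ∃ I, IsMPrimary I ∧ gCoeff 1 K I = l - q := by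
  obtain ⟨I, hI, a, haI, ha, r, k, hr, hk, hB⟩ := exists_isMPrimary_blowup_eq hR hdim B
  obtain ⟨-, l, q, hl, hq, hg⟩ := hilbertRel_of_reduction hdim hK ha haI hr hk hB
  exact ⟨l, q, hl, hq, I, hI, hg⟩

/-- A finite subalgebra is automatically integral, so the condition `B ≤ integralClosure R _` costs
nothing in either direction. -/
theorem image_deltaRel (hR : depth R R ≠ 0) (hdim : ringKrullDim R = 1)
    [Infinite (ResidueField R)] {K : Ideal R} (hK : IsMPrimary K) :
    intE '' deltaRel K = {x : EReal | ∃ B : Subalgebra R (FractionRing R),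
      B ≤ integralClosure R (FractionRing R) ∧ Module.Finite R B ∧
      x = relLength R (idealImage K) (extend K B) - lengthE R (R ⧸ K)} := by
  ext x
  constructor
  · rintro ⟨_, ⟨I, hI, rfl⟩, rfl⟩
    obtain ⟨a, haI, ha, r, k, hr, hk⟩ := exists_reduction_of_isMPrimary hR hdim hI
    have hf := finite_blowupAlgebra ha haI hr
    obtain ⟨-, l, q, hl, hq, hg⟩ := hilbertRel_of_reduction hdim hK ha haI hr hk
      (toSubmodule_blowupAlgebra ha haI hr)
    exact ⟨_, le_integralClosure_of_finite _, hf, by rw [hg, relLength_sub_lengthE hl hq]⟩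
  · rintro ⟨B, -, hB, rfl⟩
    obtain ⟨l, q, hl, hq, I, hI, hg⟩ := exists_quotLen_extend_eq hR hdim hK B
    exact ⟨_, ⟨I, hI, rfl⟩, by rw [hg, relLength_sub_lengthE hl hq]⟩

theorem sSup_relLength_sub (hR : depth R R ≠ 0) (hdim : ringKrullDim R = 1) {K : Ideal R}
    (hK : IsMPrimary K) :
    sSup {x : EReal | ∃ B : Subalgebra R (FractionRing R),
      B ≤ integralClosure R (FractionRing R) ∧ Module.Finite R B ∧
      x = relLength R (idealImage K) (extend K B) - lengthE R (R ⧸ K)} =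
    relLength R (idealImage K) (extend K (integralClosure R (FractionRing R))) -
      lengthE R (R ⧸ K) := by
  let S := {x : EReal | ∃ B : Subalgebra R (FractionRing R),
      B ≤ integralClosure R (FractionRing R) ∧ Module.Finite R B ∧
      x = relLength R (idealImage K) (extend K B) - lengthE R (R ⧸ K)}
  have hle : sSup S ≤ relLength R (idealImage K)
      (extend K (integralClosure R (FractionRing R))) - lengthE R (R ⧸ K) := by
    refine sSup_le ?_
    rintro _ ⟨B, hB, -, rfl⟩
    exact EReal.sub_le_sub (relLength_mono (extend_mono K hB)) le_rfl
  let V : Set ℕ := {l | ∃ B : Subalgebra R (FractionRing R), Module.Finite R B ∧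
    quotLen (idealImage K) (extend K B) = l}
  have hV : ∀ B : Subalgebra R (FractionRing R), Module.Finite R B →
      ∃ l ∈ V, quotLen (idealImage K) (extend K B) = l := by
    intro B hB
    obtain ⟨l, -, hl, -⟩ := exists_quotLen_extend_eq hR hdim hK B
    exact ⟨l, ⟨B, hB, hl⟩, hl⟩
  by_cases hbdd : BddAbove V
  · have hne : V.Nonempty := by
      obtain ⟨l, hl, -⟩ := hV ⊥ inferInstance
      exact ⟨l, hl⟩
    obtain ⟨B, hB, hBl⟩ := Nat.sSup_mem hne hbdd
    have hmax := extend_integralClosure_le (K := K) (B := B) (by simp [hBl]) fun B' hB' => by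
      obtain ⟨l, hl, hl'⟩ := hV B' hB'
      rw [hl', hBl]
      exact_mod_cast le_csSup hbdd hl
    rw [le_antisymm hmax (extend_mono K (le_integralClosure_of_finite B))] at hle ⊢
    exact le_antisymm hle (le_sSup ⟨B, le_integralClosure_of_finite B, hB, rfl⟩)
  -- With unbounded lengths the left side is `⊤`, hence so is the right; the shift by `q` below
  -- absorbs the subtraction of `ℓ(R / K)`.
  · refine le_antisymm hle (le_top.trans (top_le_iff.2 ?_).ge)
    obtain ⟨-, q, -, hq, -⟩ := exists_quotLen_extend_eq hR hdim hK ⊥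
    rw [EReal.eq_top_iff_forall_lt]
    intro y
    obtain ⟨n, hn⟩ := exists_nat_gt (y + q)
    rw [not_bddAbove_iff] at hbdd
    obtain ⟨l, ⟨B, hB, hl⟩, hnl⟩ := hbdd n
    refine lt_of_lt_of_le ?_ (le_sSup ⟨B, le_integralClosure_of_finite B, hB, rfl⟩)
    rw [relLength_sub_lengthE hl hq, intE]
    have : (n : ℝ) < l := by exact_mod_cast hnl
    have h2 : y < ((l - q : ℤ) : ℝ) := by
      push_cast
      linarith
    exact_mod_cast h2

end Supremum

end HilbertCoeff

theorem theorem5p9 (R : Type u) [CommRing R] [IsLocalRing R]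
    (hR : HilbertCoeff.IsCohenMacaulayRing R) (hdim : ringKrullDim R = 1)
    (hres : Infinite (IsLocalRing.ResidueField R)) :
    (∀ (M : Type v) [AddCommGroup M] [Module R M], HilbertCoeff.IsMaximalCohenMacaulay R M →
      Function.Injective (LocalizedModule.mkLinearMap R⁰ M) ∧
      (∀ I : Ideal R, HilbertCoeff.IsMPrimary I →
        HilbertCoeff.HasHilbertPolynomial (HilbertCoeff.hilbertSamuel I M) 1) ∧
      HilbertCoeff.intE '' HilbertCoeff.deltaModule R M ⊆
        {x : EReal | ∃ N : Submodule R (LocalizedModule R⁰ M),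
          HilbertCoeff.imageInLocalization R M ≤ N ∧ N.FG ∧
          x = HilbertCoeff.relLength R (HilbertCoeff.imageInLocalization R M) N}) ∧
    (∀ K : Ideal R, HilbertCoeff.IsMPrimary K →
      (∀ I : Ideal R, HilbertCoeff.IsMPrimary I →
        HilbertCoeff.HasHilbertPolynomial (HilbertCoeff.hilbertRel K I) 1) ∧
      HilbertCoeff.intE '' HilbertCoeff.deltaRel K =
        {x : EReal | ∃ B : Subalgebra R (FractionRing R),
          B ≤ integralClosure R (FractionRing R) ∧ Module.Finite R B ∧
          x = HilbertCoeff.relLength R (HilbertCoeff.idealImage K) (HilbertCoeff.extend K B)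
            - HilbertCoeff.lengthE R (R ⧸ K)} ∧
      sSup (HilbertCoeff.intE '' HilbertCoeff.deltaRel K) =
        HilbertCoeff.relLength R (HilbertCoeff.idealImage K)
            (HilbertCoeff.extend K (integralClosure R (FractionRing R)))
          - HilbertCoeff.lengthE R (R ⧸ K)) := by
  obtain ⟨hN, hdepth⟩ := hR
  have hRd : HilbertCoeff.depth R R ≠ 0 := by
    intro h
    rw [h, hdim] at hdepth
    exact absurd hdepth (by decide)
  refine ⟨fun M _ _ hM => ?_, fun K hK => ?_⟩
  · obtain ⟨-, hfin, hMd, hMR⟩ := hM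
    rw [hdim] at hMR
    have hMd' : HilbertCoeff.depth R M ≠ 0 := by
      intro h
      rw [h, hMR] at hMd
      exact absurd hMd (by decide)
    have hinj := HilbertCoeff.injective_mkLinearMap (M := M) fun s hs =>
      HilbertCoeff.isSMulRegular_of_mem_nonZeroDivisors hdim hMd' hs
    refine ⟨hinj, fun I hI =>
      (HilbertCoeff.hilbertSamuel_of_isMPrimary hRd hdim hinj hMR hI).1, ?_⟩
    rintro _ ⟨_, ⟨I, hI, rfl⟩, rfl⟩
    exact (HilbertCoeff.hilbertSamuel_of_isMPrimary hRd hdim hinj hMR hI).2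
  · have himage := HilbertCoeff.image_deltaRel hRd hdim hK
    refine ⟨fun I hI => ?_, himage, ?_⟩
    · obtain ⟨a, haI, ha, r, k, hr, hk⟩ := HilbertCoeff.exists_reduction_of_isMPrimary hRd hdim hI
      exact (HilbertCoeff.hilbertRel_of_reduction hdim hK ha haI hr hk
        (HilbertCoeff.toSubmodule_blowupAlgebra ha haI hr)).1
    · rw [himage]
      exact HilbertCoeff.sSup_relLength_sub hRd hdim hK
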